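/- Let $m\in\mathbb N$, $0<\alpha<1$, and let $\mu^-,\mu^+$ be finite Borel measures on $\mathbb R^m$. A $1$-current on $\mathbb R^m$ is a continuous linear functional on the space of smooth compactly supported $1$-forms; its boundary is $\partial T(f)=T(df)$. A rectifiable $1$-current $T=\underline{\underline{\tau}}(M,\theta,\xi)$ is one of the form $T(\omega)=\int_M\langle\omega(x),\xi(x)\rangle\,\theta(x)\,d\mathcal H^1(x)$, where $M\subset\mathbb R^m$ is $\mathcal H^1$-measurable and countably $1$-rectifiable (contained, up to an $\mathcal H^1$-null set, in countably many Lipschitz images of $\mathbb R$), $\theta>0$ is locally $\mathcal H^1$-integrable on $M$ (real-valued), and $\xi$ is $\mathcal H^1$-measurable with $\xi(x)$ a unit vector spanning the approximate tangent line $T_xM$ for $\mathcal H^1$-a.e. $x\in M$. Its cost is $\mathbf M_\alpha(T)=\int_M\theta^\alpha\,d\mathcal H^1$. $Path(\mu^-,\mu^+)$ is the set of rectifiable $1$-currents $T$ with $\partial T=\mu^+-\mu^-$ (transport paths); $T\in Path(\mu^-,\mu^+)$ is $\alpha$-optimal if $\mathbf M_\alpha(T)\le\mathbf M_\alpha(T')$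 for all $T'\in Path(\mu^-,\mu^+)$. A rectifiable $1$-current $S=\underline{\underline{\tau}}(N,\phi,\zeta)$ is on $T=\underline{\underline{\tau}}(M,\theta,\xi)$ if $\mathcal H^1(N\setminus M)=0$ and $\phi\le\theta$ $\mathcal H^1$-a.e. on $N$; it is a cycle on $T$ if moreover $\partial S=0$. $T$ is cycle-free if $0$ is the only cycle on $T$. (1) Let $T\in Path(\mu^-,\mu^+)$ with $\mathbf M_\alpha(T)<\infty$, and let $S$ be a cycle on $T$. Then $T+\epsilon S\in Path(\mu^-,\mu^+)$ for every $\epsilon\in[-1,1]$, and $$\min\{\mathbf M_\alpha(T+S),\mathbf M_\alpha(T-S)\}\le\mathbf M_\alpha(T),$$ with equality only when $S=0$. (2) If $T$ is an $\alpha$-optimal transport path from $\mu^-$ to $\mu^+$ with $\mathbf M_\alpha(T)<\infty$, then $T$ is cycle-free. -/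

import Mathlib

open MeasureTheory Filter Topology TopologicalSpace
open scoped Distributions

namespace RamifiedTransport

/-- The ambient space `ℝ^m` with its Euclidean norm. -/
abbrev Space (m : ℕ) : Type := EuclideanSpace ℝ (Fin m)

/-- `𝓓¹(ℝ^m)`: smooth compactly supported `1`-forms (covector fields) on `ℝ^m`. -/
abbrev OneForm (m : ℕ) : Type :=
  TestFunction (⊤ : Opens (Space m)) (Space m →L[ℝ] ℝ) ⊤

/-- `𝓓⁰(ℝ^m)`: smooth compactly supported functions on `ℝ^m`. -/
abbrev ZeroForm (m : ℕ) : Type :=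
  TestFunction (⊤ : Opens (Space m)) ℝ ⊤

/-- `𝓓₁(ℝ^m)`: `1`-currents, the continuous dual of the space of `1`-forms. -/
abbrev OneCurrent (m : ℕ) : Type := OneForm m →L[ℝ] ℝ

/-- `𝓓₀(ℝ^m)`: `0`-currents. -/
abbrev ZeroCurrent (m : ℕ) : Type := ZeroForm m →L[ℝ] ℝ

/-- The exterior derivative `f ↦ df` from functions to `1`-forms. -/
noncomputable def extDeriv₀ (m : ℕ) : ZeroForm m →L[ℝ] OneForm m :=
  TestFunction.fderivCLM ℝ ⊤ ⊤

theorem extDeriv₀_apply (m : ℕ) (f : ZeroForm m) (x : Space m) :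
    extDeriv₀ m f x = fderiv ℝ f x := by
  unfold extDeriv₀
  rw [TestFunction.fderivCLM_apply_of_le f (by simp)]

/-- The boundary of a `1`-current: `(∂T)(f) = T(df)`. -/
noncomputable def boundary {m : ℕ} (T : OneCurrent m) : ZeroCurrent m :=
  T.comp (extDeriv₀ m)

/-- `M` is countably `1`-rectifiable: up to an `ℋ¹`-null set it is covered by countably many
Lipschitz images of `ℝ`. -/
def CountablyOneRectifiable {m : ℕ} (M : Set (Space m)) : Prop :=
  ∃ (M₀ : Set (Space m)) (F : ℕ → ℝ → Space m),
    Measure.hausdorffMeasure 1 M₀ = 0 ∧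
    (∀ j, ∃ K : NNReal, LipschitzWith K (F j)) ∧
    M ⊆ M₀ ∪ ⋃ j, Set.range (F j)

/-- The line `ℝ v` is the approximate tangent space of `M` at `x` with respect to the
multiplicity `θ`: with `η_{x,r}(y) = (y - x) / r`, for every `f ∈ C_c(ℝ^m)`,
`∫_{η_{x,r}(M)} f(y) θ(x + r y) dℋ¹(y) → θ(x) ∫_{ℝ v} f dℋ¹` as `r ↓ 0`. -/
def IsApproxTangentLine {m : ℕ} (M : Set (Space m)) (θ : Space m → ℝ) (x v : Space m) : Prop :=
  ∀ f : Space m → ℝ, Continuous f → HasCompactSupport f →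
    Tendsto
      (fun r : ℝ => ∫ y in {y : Space m | x + r • y ∈ M}, f y * θ (x + r • y)
        ∂(Measure.hausdorffMeasure 1))
      (𝓝[>] 0)
      (𝓝 (θ x * ∫ y in (Submodule.span ℝ {v} : Set (Space m)), f y
        ∂(Measure.hausdorffMeasure 1)))

/-- A triple `(M, θ, ξ)` as it occurs in the notation `τ(M, θ, ξ)` for rectifiable `1`-currents:
`M` is an `ℋ¹`-measurable countably `1`-rectifiable set, `θ` is a positive locally `ℋ¹`-integrable
multiplicity on `M`, and `ξ` is an `ℋ¹`-measurable field such that `ξ(x)` is, for `ℋ¹`-a.e.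
`x ∈ M`, a unit vector spanning the approximate tangent line of `M` at `x`.
(The values of `θ` and `ξ` outside `M` are irrelevant.) -/
structure RectifiableTriple (m : ℕ) where
  /-- the carrying set `M` -/
  carrier : Set (Space m)
  /-- the multiplicity `θ` -/
  mult : Space m → ℝ
  /-- the orientation `ξ` -/
  orient : Space m → Space m
  nullMeasurableSet_carrier : NullMeasurableSet carrier (Measure.hausdorffMeasure 1)
  rectifiable_carrier : CountablyOneRectifiable carrier
  mult_pos : ∀ x ∈ carrier, 0 < mult x
  locallyIntegrable_mult :
    LocallyIntegrable mult ((Measure.hausdorffMeasure 1).restrict carrier)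
  aestronglyMeasurable_orient :
    AEStronglyMeasurable orient ((Measure.hausdorffMeasure 1).restrict carrier)
  orient_tangent : ∀ᵐ x ∂((Measure.hausdorffMeasure 1).restrict carrier),
    ‖orient x‖ = 1 ∧ IsApproxTangentLine carrier mult x (orient x)

/-- `T = τ(M, θ, ξ)`, i.e. `T(ω) = ∫_M ⟨ω(x), ξ(x)⟩ θ(x) dℋ¹(x)` for all `1`-forms `ω`. -/
def RectifiableTriple.Represents {m : ℕ} (R : RectifiableTriple m) (T : OneCurrent m) : Prop :=
  ∀ ω : OneForm m,
    T ω = ∫ x in R.carrier, ω x (R.orient x) * R.mult x ∂(Measure.hausdorffMeasure 1)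

/-- `T` is a (real) rectifiable `1`-current in `ℝ^m`. -/
def IsRectifiable {m : ℕ} (T : OneCurrent m) : Prop :=
  ∃ R : RectifiableTriple m, R.Represents T

/-- `T ∈ Path(μ⁻, μ⁺)`: `T` is a rectifiable `1`-current with `∂T = μ⁺ - μ⁻`. -/
def IsTransportPath {m : ℕ} (μminus μplus : Measure (Space m)) (T : OneCurrent m) : Prop :=
  IsRectifiable T ∧
    ∀ f : ZeroForm m, boundary T f = (∫ x, f x ∂μplus) - ∫ x, f x ∂μminus

/-- The integral `∫_M θ^α dℋ¹` of a triple `(M, θ, ξ)`. -/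
noncomputable def RectifiableTriple.cost {m : ℕ} (α : ℝ) (R : RectifiableTriple m) : ENNReal :=
  ∫⁻ x in R.carrier, ENNReal.ofReal (R.mult x ^ α) ∂(Measure.hausdorffMeasure 1)

/-- The transport cost `M_α(T) = ∫_M θ^α dℋ¹` of `T = τ(M, θ, ξ)`. The set `M` and the
multiplicity `θ` are determined by `T` up to `ℋ¹`-null sets, so the infimum ranges over
a single value when `T` is rectifiable; it is `∞` when `T` is not rectifiable. -/
noncomputable def transportCost {m : ℕ} (α : ℝ) (T : OneCurrent m) : ENNReal :=
  ⨅ (R : RectifiableTriple m) (_ : R.Represents T), R.cost α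

/-- `S = τ(N, φ, ζ)` is on `T = τ(M, θ, ξ)`: `ℋ¹(N \ M) = 0` and `φ ≤ θ` `ℋ¹`-a.e. on `N`. -/
def IsOn {m : ℕ} (S T : OneCurrent m) : Prop :=
  ∃ RS RT : RectifiableTriple m, RS.Represents S ∧ RT.Represents T ∧
    Measure.hausdorffMeasure 1 (RS.carrier \ RT.carrier) = 0 ∧
    ∀ᵐ x ∂((Measure.hausdorffMeasure 1).restrict RS.carrier), RS.mult x ≤ RT.mult x

/-- `S` is a cycle on `T`. -/
def IsCycleOn {m : ℕ} (S T : OneCurrent m) : Prop :=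
  IsOn S T ∧ boundary S = 0

/-- The rectifiable current `T` is cycle-free: the zero current is the only cycle on `T`. -/
def IsCycleFree {m : ℕ} (T : OneCurrent m) : Prop :=
  IsRectifiable T ∧ ∀ S : OneCurrent m, IsCycleOn S T → S = 0

/-- `T` is an `α`-optimal transport path from `μ⁻` to `μ⁺`: it minimizes `M_α` among all
transport paths from `μ⁻` to `μ⁺`. -/
def IsOptimalPath {m : ℕ} (α : ℝ) (μminus μplus : Measure (Space m)) (T : OneCurrent m) : Prop :=
  IsTransportPath μminus μplus T ∧
    ∀ T' : OneCurrent m, IsTransportPath μminus μplus T' → transportCost α T ≤ transportCost α T'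

end RamifiedTransport

/-!
Write `T = τ(M, θ, ξ)` and let `S = τ(N, φ, ζ)` be a cycle on `T`. The proof rewrites `S` along the
orientation of `T`: `S(ω) = ∫_M ⟨ω, ξ⟩ w dℋ¹` with a signed multiplicity `w`, `|w| ≤ θ`. Then, for
`|ε| ≤ 1`, the current `T + ε S` is `τ(M ∩ {θ + ε w > 0}, θ + ε w, ξ)`, and
`M_α(T + ε S) = ∫_M (θ + ε w)^α dℋ¹`. Strict concavity of `t ↦ t ^ α` gives
`(θ + w)^α + (θ - w)^α ≤ 2 θ^α`, strictly where `w ≠ 0`, hence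
`M_α(T + S) + M_α(T - S) ≤ 2 M_α(T) < ∞` with equality only if `w = 0` almost everywhere, that is
`S = 0` (`IsOn.min_transportCost_le`). As `∂S = 0`, both `T ± S` have the boundary of `T`, so an
optimal `T` forces equality and is cycle-free.

Three facts about rectifiable triples carry this.

* Approximate tangent lines are local (`ae_isApproxTangentLine_of_abs_le`). The blow-ups at `x` of
  a measure `θ ℋ¹` restricted to `M` converge to `θ(x) ℋ¹` on a line; if `|u| ≤ C θ` on `N ⊆ M`,
  then at every Lebesgue point of `1_N u / θ` with respect to the locally finite measure `θ ℋ¹`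
  restricted to `M`, the blow-ups of `u ℋ¹` restricted to `N` converge to `u(x) ℋ¹` on the same
  line. Lebesgue points are provided by the Besicovitch covering theorem, and no structure theory of
  rectifiable sets is used.
* Approximate tangent lines are unique (`IsApproxTangentLine.eq_inner_smul`). With locality this
  gives `ζ = ⟪ξ, ζ⟫ ξ` almost everywhere on `N`, and `w = 1_N φ ⟪ξ, ζ⟫`
  (`IsOn.exists_signed_mult`).
* A current determines the density `θ ξ` of any triple representing it
  (`RectifiableTriple.Represents.density_ae_eq`), so the infimum defining the transport cost is the
  cost of every representing triple.
-/

namespace RamifiedTransport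

/-! ### Blow-ups and locality of approximate tangent lines -/

open scoped Pointwise in
/-- Under `y ↦ x + r y` the measure `ℋ¹` scales by `r⁻¹`. No measurability is needed, because the
map is a homeomorphism. -/
theorem setIntegral_homothety_preimage {m : ℕ} (g : Space m → ℝ) (s : Set (Space m)) (x : Space m)
    {r : ℝ} (hr : 0 < r) :
    ∫ y in {y : Space m | x + r • y ∈ s}, g (x + r • y) ∂(Measure.hausdorffMeasure 1) =
      r⁻¹ * ∫ z in s, g z ∂(Measure.hausdorffMeasure 1) := by
  let e : Space m ≃ₜ Space m := (Homeomorph.smulOfNeZero r hr.ne').trans (Homeomorph.addLeft x)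
  have he : ∀ y, e y = x + r • y := fun y => rfl
  have hmap : Measure.map e (Measure.hausdorffMeasure 1 : Measure (Space m)) =
      ENNReal.ofReal r⁻¹ • Measure.hausdorffMeasure 1 := by
    ext t ht
    rw [Measure.map_apply e.continuous.measurable ht]
    have h1 : e ⁻¹' t = r⁻¹ • ((fun y => x + y) ⁻¹' t) := by
      ext y
      rw [Set.mem_inv_smul_set_iff₀ hr.ne']
      rfl
    rw [h1, Measure.hausdorffMeasure_smul₀ zero_le_one (inv_ne_zero hr.ne'),
      measure_preimage_add, Measure.smul_apply, NNReal.rpow_one, ENNReal.smul_def,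
      Real.nnnorm_of_nonneg (inv_pos.2 hr).le, ENNReal.ofReal_eq_coe_nnreal (inv_pos.2 hr).le]
  have h2 := e.toMeasurableEquiv.measurableEmbedding.setIntegral_map
    (μ := (Measure.hausdorffMeasure 1 : Measure (Space m))) g s
  have h3 : (e.toMeasurableEquiv : Space m → Space m) = e := rfl
  rw [h3, hmap, Measure.restrict_smul, integral_smul_measure,
    ENNReal.toReal_ofReal (inv_pos.2 hr).le] at h2
  exact h2.symm

/-- The blow-up in the definition of approximate tangent lines, written as an integral over the
unscaled set: in this form Lebesgue differentiation applies. -/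
theorem isApproxTangentLine_iff {m : ℕ} {M : Set (Space m)} {θ : Space m → ℝ} {x v : Space m} :
    IsApproxTangentLine M θ x v ↔ ∀ f : Space m → ℝ, Continuous f → HasCompactSupport f →
      Tendsto (fun r : ℝ => r⁻¹ * ∫ z in M, f (r⁻¹ • (z - x)) * θ z ∂(Measure.hausdorffMeasure 1))
        (𝓝[>] 0)
        (𝓝 (θ x * ∫ y in (Submodule.span ℝ {v} : Set (Space m)), f y
          ∂(Measure.hausdorffMeasure 1))) := by
  unfold IsApproxTangentLine
  refine forall_congr' fun f => forall_congr' fun _ => forall_congr' fun _ =>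
    tendsto_congr' ?_
  filter_upwards [self_mem_nhdsWithin] with r hr
  rw [← setIntegral_homothety_preimage _ _ x hr]
  have : ∀ y : Space m, r⁻¹ • (x + r • y - x) = y := fun y => by
    rw [add_sub_cancel_left, inv_smul_smul₀ (ne_of_gt hr)]
  simp only [this]

/-- Blow-up limits are stable under bounded reweighting of the measure: this is where Lebesgue
points for the Besicovitch Vitali family enter. The functional `K` stands for integration over
the tangent line. -/
theorem ae_tendsto_blowup_of_abs_le {E : Type*} [NormedAddCommGroup E] [NormedSpace ℝ E]
    [FiniteDimensional ℝ E] [MeasurableSpace E] [BorelSpace E] {μ : Measure E} {θ w : E → ℝ}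
    (hθ : LocallyIntegrable θ μ) (hpos : ∀ᵐ x ∂μ, 0 < θ x) (hw : AEStronglyMeasurable w μ)
    {C : ℝ} (hC : ∀ᵐ x ∂μ, |w x| ≤ C * θ x) :
    ∀ᵐ x ∂μ, ∀ K : (E → ℝ) → ℝ,
      (∀ f : E → ℝ, Continuous f → HasCompactSupport f →
        Tendsto (fun r : ℝ => r⁻¹ * ∫ z, f (r⁻¹ • (z - x)) * θ z ∂μ) (𝓝[>] 0)
          (𝓝 (θ x * K f))) →
      ∀ f : E → ℝ, Continuous f → HasCompactSupport f →
        Tendsto (fun r : ℝ => r⁻¹ * ∫ z, f (r⁻¹ • (z - x)) * w z ∂μ) (𝓝[>] 0)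
          (𝓝 (w x * K f)) := by
  have hθm : AEMeasurable θ μ := hθ.aestronglyMeasurable.aemeasurable
  have hdm : AEMeasurable (fun x => ENNReal.ofReal (θ x)) μ := hθm.ennreal_ofReal
  -- `θ μ` is locally finite, unlike `μ`, so the differentiation theorem applies to it and `w / θ`
  set ν : Measure E := μ.withDensity fun x => ENNReal.ofReal (θ x) with hν
  have hνμ : ν ≪ μ := withDensity_absolutelyContinuous _ _
  have hμν : μ ≪ ν := withDensity_absolutelyContinuous' hdm (by
    filter_upwards [hpos] with x hx
    simpa using hx)
  have : IsLocallyFiniteMeasure ν := by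
    refine ⟨fun x => ?_⟩
    obtain ⟨U, hU, hi⟩ := hθ x
    obtain ⟨V, hVU, hV, hxV⟩ := mem_nhds_iff.1 hU
    refine ⟨V, hV.mem_nhds hxV, ?_⟩
    rw [hν, withDensity_apply _ hV.measurableSet]
    exact (hi.mono_set hVU).lintegral_lt_top
  have hint : ∀ g : E → ℝ, ∫ z, g z ∂ν = ∫ z, g z * θ z ∂μ := fun g => by
    rw [hν, integral_withDensity_eq_integral_toReal_smul₀ hdm (by simp)]
    refine integral_congr_ae ?_
    filter_upwards [hpos] with z hz
    rw [ENNReal.toReal_ofReal hz.le, smul_eq_mul, mul_comm]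
  set h : E → ℝ := fun z => w z / θ z with hh
  have hhm : AEStronglyMeasurable h ν :=
    (hw.aemeasurable.div hθm).aestronglyMeasurable.mono_ac hνμ
  have hhb : ∀ᵐ z ∂ν, ‖h z‖ ≤ C := by
    refine hνμ.ae_le ?_
    filter_upwards [hpos, hC] with z hz hz'
    rw [hh, Real.norm_eq_abs, abs_div, abs_of_pos hz, div_le_iff₀ hz]
    exact hz'
  have hhl : LocallyIntegrable h ν := by
    refine (locallyIntegrable_const C).mono hhm ?_
    filter_upwards [hhb] with z hz using hz.trans (le_abs_self C)
  have hleb := hμν.ae_le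
    ((Besicovitch.vitaliFamily ν).ae_tendsto_average_norm_sub hhl)
  filter_upwards [hleb, hpos] with x hx hθx K hK f hf hfc
  obtain ⟨R₀, hR₀⟩ := hfc.isCompact.isBounded.subset_closedBall (0 : E)
  set R : ℝ := max R₀ 1 with hR
  have hRpos : 0 < R := lt_of_lt_of_le one_pos (le_max_right _ _)
  have hfR : ∀ y : E, R < ‖y‖ → f y = 0 := fun y hy => by
    refine image_eq_zero_of_notMem_tsupport fun hy' => ?_
    have := hR₀ hy'
    rw [mem_closedBall_zero_iff] at this
    exact absurd (this.trans (le_max_left _ _)) (not_le.2 hy)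
  obtain ⟨F, hF⟩ := hf.bounded_above_of_compact_support hfc
  -- a continuous cutoff that is at least `1` on the ball of radius `R`
  set b : E → ℝ := fun y => max 0 (R + 1 - ‖y‖) with hb
  have hbc : Continuous b := by fun_prop
  have hbs : HasCompactSupport b := by
    refine HasCompactSupport.intro (isCompact_closedBall (0 : E) (R + 1)) fun y hy => ?_
    rw [mem_closedBall_zero_iff, not_le] at hy
    exact max_eq_left (by linarith)
  have hscale : ∀ {g : E → ℝ}, Continuous g → HasCompactSupport g → ∀ {r : ℝ}, 0 < r →
      Continuous (fun z => g (r⁻¹ • (z - x))) ∧ HasCompactSupport (fun z => g (r⁻¹ • (z - x))) := by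
    intro g hg hgc r hr
    refine ⟨by fun_prop, ?_⟩
    exact hgc.comp_homeomorph
      ((Homeomorph.subRight x).trans (Homeomorph.smulOfNeZero r⁻¹ (inv_ne_zero hr.ne')))
  have hE := hK f hf hfc
  have hB := hK b hbc hbs
  have hA : Tendsto (fun r : ℝ => ⨍ z in Metric.closedBall x (R * r), ‖h z - h x‖ ∂ν)
      (𝓝[>] 0) (𝓝 0) := by
    refine (hx.comp (Besicovitch.tendsto_filterAt ν x)).comp ?_
    refine tendsto_nhdsWithin_iff.2 ⟨?_, ?_⟩
    · have : Tendsto (fun r : ℝ => R * r) (𝓝 0) (𝓝 (R * 0)) := tendsto_id.const_mul R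
      rw [mul_zero] at this
      exact this.mono_left nhdsWithin_le_nhds
    · filter_upwards [self_mem_nhdsWithin] with r hr using mul_pos hRpos hr
  -- the blow-ups of `w μ` and of `(w x / θ x) θ μ` at `x` have the same limit, since the mass that
  -- `θ μ` gives to balls of radius `R r` is at most of order `r`
  have hdiff : Tendsto (fun r : ℝ => r⁻¹ * ∫ z, f (r⁻¹ • (z - x)) * w z ∂μ -
      h x * (r⁻¹ * ∫ z, f (r⁻¹ • (z - x)) * θ z ∂μ)) (𝓝[>] 0) (𝓝 0) := by
    have hlim : Tendsto (fun r : ℝ => F * ((r⁻¹ * ∫ z, b (r⁻¹ • (z - x)) * θ z ∂μ) *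
        ⨍ z in Metric.closedBall x (R * r), ‖h z - h x‖ ∂ν)) (𝓝[>] 0) (𝓝 0) := by
      simpa using (hB.mul hA).const_mul F
    refine squeeze_zero_norm' ?_ hlim
    filter_upwards [self_mem_nhdsWithin] with r hr
    have hr : 0 < r := hr
    have hwν : ∫ z, f (r⁻¹ • (z - x)) * w z ∂μ = ∫ z, f (r⁻¹ • (z - x)) * h z ∂ν := by
      rw [hint]
      refine integral_congr_ae ?_
      filter_upwards [hpos] with z hz
      rw [hh, mul_assoc, div_mul_cancel₀ _ hz.ne']
    obtain ⟨hfr, hfrc⟩ := hscale hf hfc hr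
    obtain ⟨hbr, hbrc⟩ := hscale hbc hbs hr
    have hfi : Integrable (fun z => f (r⁻¹ • (z - x))) ν :=
      hfr.integrable_of_hasCompactSupport hfrc
    have hbi : Integrable (fun z => b (r⁻¹ • (z - x))) ν :=
      hbr.integrable_of_hasCompactSupport hbrc
    have hfhi : Integrable (fun z => f (r⁻¹ • (z - x)) * h z) ν :=
      hfi.mul_bdd hhm hhb
    have hoff : ∀ z, z ∉ Metric.closedBall x (R * r) → R < ‖r⁻¹ • (z - x)‖ := by
      intro z hz
      rw [Metric.mem_closedBall, not_le, dist_eq_norm] at hz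
      rwa [norm_smul, Real.norm_of_nonneg (inv_pos.2 hr).le, ← div_eq_inv_mul, lt_div_iff₀ hr]
    have hfin : ν (Metric.closedBall x (R * r)) ≠ ⊤ :=
      (isCompact_closedBall x (R * r)).measure_lt_top.ne
    have hsubi : IntegrableOn (fun z => ‖h z - h x‖) (Metric.closedBall x (R * r)) ν :=
      ((hhl.integrableOn_isCompact (isCompact_closedBall _ _)).sub
        (integrableOn_const hfin)).norm
    rw [hwν, ← hint (fun z => f (r⁻¹ • (z - x)))]
    have e1 : r⁻¹ * ∫ z, f (r⁻¹ • (z - x)) * h z ∂ν - h x * (r⁻¹ * ∫ z, f (r⁻¹ • (z - x)) ∂ν) =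
        r⁻¹ * ∫ z in Metric.closedBall x (R * r), f (r⁻¹ • (z - x)) * (h z - h x) ∂ν := by
      rw [setIntegral_eq_integral_of_forall_compl_eq_zero fun z hz => by
        rw [hfR _ (hoff z hz), zero_mul]]
      simp only [mul_sub]
      rw [integral_sub hfhi (hfi.mul_const _), integral_mul_const]
      ring
    have e2 : ‖∫ z in Metric.closedBall x (R * r), f (r⁻¹ • (z - x)) * (h z - h x) ∂ν‖ ≤
        F * ∫ z in Metric.closedBall x (R * r), ‖h z - h x‖ ∂ν := by
      rw [← integral_const_mul]
      refine norm_integral_le_of_norm_le (hsubi.const_mul F) (Eventually.of_forall fun z => ?_)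
      rw [norm_mul]
      exact mul_le_mul_of_nonneg_right (hF _) (norm_nonneg _)
    have e3 : ∫ z in Metric.closedBall x (R * r), ‖h z - h x‖ ∂ν =
        ν.real (Metric.closedBall x (R * r)) *
          ⨍ z in Metric.closedBall x (R * r), ‖h z - h x‖ ∂ν :=
      (measure_smul_setAverage _ hfin).symm
    have e4 : ν.real (Metric.closedBall x (R * r)) ≤ ∫ z, b (r⁻¹ • (z - x)) * θ z ∂μ := by
      rw [← hint (fun z => b (r⁻¹ • (z - x)))]
      calc ν.real (Metric.closedBall x (R * r))
          = ∫ z in Metric.closedBall x (R * r), (1 : ℝ) ∂ν := by simp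
        _ ≤ ∫ z in Metric.closedBall x (R * r), b (r⁻¹ • (z - x)) ∂ν := by
            refine setIntegral_mono_on (integrableOn_const hfin) hbi.integrableOn
              measurableSet_closedBall fun z hz => ?_
            rw [Metric.mem_closedBall, dist_eq_norm] at hz
            have : ‖r⁻¹ • (z - x)‖ ≤ R := by
              rwa [norm_smul, Real.norm_of_nonneg (inv_pos.2 hr).le, ← div_eq_inv_mul,
                div_le_iff₀ hr]
            exact le_max_of_le_right (by linarith)
        _ ≤ ∫ z, b (r⁻¹ • (z - x)) ∂ν :=
            setIntegral_le_integral hbi (Eventually.of_forall fun z => le_max_left _ _)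
    have hav : 0 ≤ ⨍ z in Metric.closedBall x (R * r), ‖h z - h x‖ ∂ν :=
      integral_nonneg fun z => norm_nonneg _
    have hF0 : 0 ≤ F := (norm_nonneg _).trans (hF 0)
    rw [e1, norm_mul, Real.norm_of_nonneg (inv_pos.2 hr).le]
    calc r⁻¹ * ‖∫ z in Metric.closedBall x (R * r), f (r⁻¹ • (z - x)) * (h z - h x) ∂ν‖
        ≤ r⁻¹ * (F * (ν.real (Metric.closedBall x (R * r)) *
          ⨍ z in Metric.closedBall x (R * r), ‖h z - h x‖ ∂ν)) := by
          rw [← e3]; gcongr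
      _ ≤ r⁻¹ * (F * ((∫ z, b (r⁻¹ • (z - x)) * θ z ∂μ) *
          ⨍ z in Metric.closedBall x (R * r), ‖h z - h x‖ ∂ν)) := by gcongr
      _ = _ := by ring
  have hfinal := hdiff.add (hE.const_mul (h x))
  have hval : 0 + h x * (θ x * K f) = w x * K f := by
    rw [zero_add, ← mul_assoc, hh, div_mul_cancel₀ _ hθx.ne']
  rw [hval] at hfinal
  refine hfinal.congr fun r => ?_
  ring

theorem restrict_restrict_of_ae_le {X : Type*} [MeasurableSpace X] {μ : Measure X} {s t : Set X}
    (hs : NullMeasurableSet s μ) (hst : s ≤ᵐ[μ] t) : (μ.restrict t).restrict s = μ.restrict s := by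
  rw [Measure.restrict_restrict₀ (hs.mono Measure.restrict_le_self)]
  refine Measure.restrict_congr_set ?_
  filter_upwards [hst] with x hx
  exact propext ⟨fun h => h.1, fun h => ⟨h, hx h⟩⟩

theorem setIntegral_indicator_of_ae_le {X : Type*} [MeasurableSpace X] {μ : Measure X}
    {s t : Set X} (hs : NullMeasurableSet s μ) (hst : s ≤ᵐ[μ] t) (g : X → ℝ) :
    ∫ x in t, s.indicator g x ∂μ = ∫ x in s, g x ∂μ := by
  rw [integral_indicator₀ (hs.mono Measure.restrict_le_self), restrict_restrict_of_ae_le hs hst]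

/-- Locality of approximate tangent lines: they are inherited by subsets whose multiplicity is
dominated by a multiple of the original one. -/
theorem ae_isApproxTangentLine_of_abs_le {m : ℕ} {M N : Set (Space m)} {θ u : Space m → ℝ}
    (hM : NullMeasurableSet M (Measure.hausdorffMeasure 1))
    (hN : NullMeasurableSet N (Measure.hausdorffMeasure 1))
    (hNM : N ≤ᵐ[Measure.hausdorffMeasure 1] M)
    (hpos : ∀ x ∈ M, 0 < θ x)
    (hθ : LocallyIntegrable θ ((Measure.hausdorffMeasure 1).restrict M))
    (hu : AEStronglyMeasurable u ((Measure.hausdorffMeasure 1).restrict N))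
    {C : ℝ} (hC0 : 0 ≤ C)
    (hC : ∀ᵐ x ∂((Measure.hausdorffMeasure 1).restrict N), |u x| ≤ C * θ x) :
    ∀ᵐ x ∂((Measure.hausdorffMeasure 1).restrict N), ∀ v : Space m,
      IsApproxTangentLine M θ x v → IsApproxTangentLine N u x v := by
  have hw : AEStronglyMeasurable (N.indicator u) ((Measure.hausdorffMeasure 1).restrict M) :=
    ((aestronglyMeasurable_indicator_iff₀ hN).2 hu).mono_measure Measure.restrict_le_self
  have hpos' : ∀ᵐ x ∂((Measure.hausdorffMeasure 1).restrict M), 0 < θ x := by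
    filter_upwards [ae_restrict_mem₀ hM] with x hx using hpos x hx
  have hwC : ∀ᵐ x ∂((Measure.hausdorffMeasure 1).restrict M),
      |N.indicator u x| ≤ C * θ x := by
    filter_upwards [hpos', ae_restrict_of_ae ((ae_restrict_iff'₀ hN).1 hC)] with x hx hx'
    by_cases hxN : x ∈ N
    · rw [Set.indicator_of_mem hxN]; exact hx' hxN
    · rw [Set.indicator_of_notMem hxN, abs_zero]; positivity
  have key := ae_tendsto_blowup_of_abs_le hθ hpos' hw hwC
  have hle : (Measure.hausdorffMeasure 1).restrict N ≤ (Measure.hausdorffMeasure 1).restrict M :=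
    Measure.restrict_mono_ae hNM
  filter_upwards [ae_mono hle key, ae_restrict_mem₀ hN] with x hx hxN v hv
  rw [isApproxTangentLine_iff] at hv ⊢
  intro f hf hfc
  have := hx (fun f => ∫ y in (Submodule.span ℝ {v} : Set (Space m)), f y
    ∂(Measure.hausdorffMeasure 1)) hv f hf hfc
  rw [Set.indicator_of_mem hxN] at this
  refine this.congr fun r => ?_
  rw [← setIntegral_indicator_of_ae_le hN hNM]
  congr 2 with z
  by_cases hz : z ∈ N <;> simp [hz]

/-! ### Uniqueness of approximate tangent lines -/

theorem setIntegral_span_singleton {m : ℕ} {v : Space m} (hv : ‖v‖ = 1) {f : Space m → ℝ}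
    (hf : Continuous f) :
    ∫ y in (Submodule.span ℝ {v} : Set (Space m)), f y ∂(Measure.hausdorffMeasure 1) =
      ∫ t : ℝ, f (t • v) := by
  have hiso : Isometry (LinearMap.toSpanSingleton ℝ (Space m) v) := by
    refine AddMonoidHomClass.isometry_of_norm _ fun t => ?_
    rw [LinearMap.toSpanSingleton_apply, norm_smul, hv, mul_one]
  have hmap := hiso.map_hausdorffMeasure (d := 1) (Or.inl zero_le_one)
  have hrange : Set.range (LinearMap.toSpanSingleton ℝ (Space m) v) =
      (Submodule.span ℝ {v} : Set (Space m)) := by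
    rw [← LinearMap.range_toSpanSingleton]; rfl
  rw [hrange, hausdorffMeasure_real] at hmap
  rw [← hmap, integral_map hiso.continuous.aemeasurable hf.aestronglyMeasurable]
  rfl

/-- Approximate tangent lines are unique. -/
theorem IsApproxTangentLine.eq_inner_smul {m : ℕ} {M : Set (Space m)} {θ : Space m → ℝ}
    {x v w : Space m} (hθ : θ x ≠ 0) (hv : ‖v‖ = 1) (hw : ‖w‖ = 1)
    (h1 : IsApproxTangentLine M θ x v) (h2 : IsApproxTangentLine M θ x w) :
    w = inner ℝ v w • v := by
  have hmem : w ∈ Submodule.span ℝ {v} := by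
    by_contra hnot
    -- a bump at `w` whose support misses the line spanned by `v` separates the two limits
    have hclosed : IsClosed (Submodule.span ℝ {v} : Set (Space m)) :=
      Submodule.closed_of_finiteDimensional _
    set δ := Metric.infDist w (Submodule.span ℝ {v} : Set (Space m)) with hδ
    have hδpos : 0 < δ :=
      (hclosed.notMem_iff_infDist_pos ⟨0, Submodule.zero_mem _⟩).1 hnot
    set f : Space m → ℝ := fun y => max 0 (δ - dist w y) with hf
    have hfc : Continuous f := by fun_prop
    have hfs : HasCompactSupport f := by
      refine HasCompactSupport.intro (isCompact_closedBall w δ) fun y hy => ?_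
      rw [Metric.mem_closedBall', not_le] at hy
      exact max_eq_left (by linarith)
    have heq := mul_left_cancel₀ hθ (tendsto_nhds_unique (h1 f hfc hfs) (h2 f hfc hfs))
    rw [setIntegral_span_singleton hv hfc, setIntegral_span_singleton hw hfc] at heq
    have hz : ∀ t : ℝ, f (t • v) = 0 := fun t => by
      have : δ ≤ dist w (t • v) :=
        Metric.infDist_le_dist_of_mem (Submodule.smul_mem _ t (Submodule.mem_span_singleton_self v))
      exact max_eq_left (by linarith)
    simp only [hz, integral_zero] at heq
    have hiso : Isometry (LinearMap.toSpanSingleton ℝ (Space m) w) := by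
      refine AddMonoidHomClass.isometry_of_norm _ fun t => ?_
      rw [LinearMap.toSpanSingleton_apply, norm_smul, hw, mul_one]
    have hpos : 0 < ∫ t : ℝ, f (t • w) := by
      refine Continuous.integral_pos_of_hasCompactSupport_nonneg_nonzero (x := 1) (by fun_prop)
        (hfs.comp_isClosedEmbedding hiso.isClosedEmbedding)
        (fun t => le_max_left _ _) ?_
      rw [hf]
      simp [hδpos]
    exact hpos.ne heq
  obtain ⟨c, rfl⟩ := Submodule.mem_span_singleton.1 hmem
  rw [inner_smul_right, real_inner_self_eq_norm_sq, hv]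
  simp

/-! ### Reweighted triples and the transport cost of a represented current -/

namespace RectifiableTriple

variable {m : ℕ}

/-- The measure `ℋ¹` restricted to the carrier. -/
noncomputable abbrev lengthMeasure (R : RectifiableTriple m) : Measure (Space m) :=
  (Measure.hausdorffMeasure 1).restrict R.carrier

theorem ae_mult_pos (R : RectifiableTriple m) : ∀ᵐ x ∂(R.lengthMeasure), 0 < R.mult x := by
  filter_upwards [ae_restrict_mem₀ R.nullMeasurableSet_carrier] with x hx using R.mult_pos x hx

theorem integrable_apply_orient_mul (R : RectifiableTriple m) (ω : OneForm m) {u : Space m → ℝ}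
    (hu : AEStronglyMeasurable u R.lengthMeasure) {C : ℝ}
    (hC : ∀ᵐ x ∂(R.lengthMeasure), |u x| ≤ C * R.mult x) :
    Integrable (fun x => ω x (R.orient x) * u x) R.lengthMeasure := by
  have h1 : Integrable (fun x => ‖ω x‖ • R.mult x) R.lengthMeasure :=
    R.locallyIntegrable_mult.integrable_smul_left_of_hasCompactSupport ω.continuous.norm
      ω.hasCompactSupport.norm
  refine (h1.const_mul C).mono' ?_ ?_
  · exact (isBoundedBilinearMap_apply.continuous.comp_aestronglyMeasurable
      (ω.continuous.aestronglyMeasurable.prodMk R.aestronglyMeasurable_orient)).mul hu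
  · filter_upwards [R.orient_tangent, hC] with x hx hx'
    rw [norm_mul, Real.norm_eq_abs (u x), smul_eq_mul]
    have h2 : ‖ω x (R.orient x)‖ ≤ ‖ω x‖ := by
      simpa [hx.1] using (ω x).le_opNorm (R.orient x)
    calc ‖ω x (R.orient x)‖ * |u x| ≤ ‖ω x‖ * (C * R.mult x) := by gcongr
      _ = _ := by ring

/-- Replacing the multiplicity `θ` of a triple by a function `0 ≤ u ≤ C θ`, and the carrier by the
part of it where `u` is positive, gives again a rectifiable triple. -/
theorem exists_reweight (R : RectifiableTriple m) {u : Space m → ℝ}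
    (hu : AEStronglyMeasurable u R.lengthMeasure) (h0 : ∀ᵐ x ∂(R.lengthMeasure), 0 ≤ u x)
    {C : ℝ} (hC0 : 0 ≤ C) (hC : ∀ᵐ x ∂(R.lengthMeasure), u x ≤ C * R.mult x) :
    ∃ R' : RectifiableTriple m,
      (∀ T : OneCurrent m, R'.Represents T ↔
        ∀ ω, T ω = ∫ x, ω x (R.orient x) * u x ∂(R.lengthMeasure)) ∧
      ∀ α : ℝ, 0 < α → R'.cost α = ∫⁻ x, ENNReal.ofReal (u x ^ α) ∂(R.lengthMeasure) := by
  -- the zero set of `u` has to be removed, as multiplicities are positive on the carrier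
  set N : Set (Space m) := {x | 0 < u x} ∩ R.carrier with hNdef
  have hN : NullMeasurableSet N (Measure.hausdorffMeasure 1) :=
    (nullMeasurableSet_restrict R.nullMeasurableSet_carrier).1
      (nullMeasurableSet_lt aemeasurable_const hu.aemeasurable)
  have hsub : N ⊆ R.carrier := Set.inter_subset_right
  have hle : (Measure.hausdorffMeasure 1).restrict N ≤ R.lengthMeasure :=
    Measure.restrict_mono_set _ hsub
  have habs : ∀ᵐ x ∂(R.lengthMeasure), |u x| ≤ C * R.mult x := by
    filter_upwards [h0, hC] with x hx hx'
    rwa [abs_of_nonneg hx]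
  have hoff : ∀ᵐ x ∂(R.lengthMeasure), x ∉ N → u x = 0 := by
    filter_upwards [h0, ae_restrict_mem₀ R.nullMeasurableSet_carrier] with x hx hxM hxN
    by_contra hne
    exact hxN ⟨lt_of_le_of_ne hx (Ne.symm hne), hxM⟩
  have hres : R.lengthMeasure.restrict N = (Measure.hausdorffMeasure 1).restrict N :=
    restrict_restrict_of_ae_le hN (LE.le.eventuallyLE hsub)
  have hNR : NullMeasurableSet N R.lengthMeasure := hN.mono Measure.restrict_le_self
  refine ⟨{ carrier := N
            mult := u
            orient := R.orient
            nullMeasurableSet_carrier := hN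
            rectifiable_carrier := ?_
            mult_pos := fun x hx => hx.1
            locallyIntegrable_mult := ?_
            aestronglyMeasurable_orient := R.aestronglyMeasurable_orient.mono_measure hle
            orient_tangent := ?_ }, ?_, ?_⟩
  · obtain ⟨M₀, F, hM₀, hF, hcov⟩ := R.rectifiable_carrier
    exact ⟨M₀, F, hM₀, hF, hsub.trans hcov⟩
  · refine LocallyIntegrable.mono_measure ?_ hle
    refine (R.locallyIntegrable_mult.smul C).mono hu ?_
    filter_upwards [habs] with x hx
    exact hx.trans (le_abs_self _)
  · filter_upwards [ae_mono hle R.orient_tangent,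
      ae_isApproxTangentLine_of_abs_le R.nullMeasurableSet_carrier hN
        (LE.le.eventuallyLE hsub)
        R.mult_pos R.locallyIntegrable_mult (hu.mono_measure hle) hC0 (ae_mono hle habs)]
      with x hx hx'
    exact ⟨hx.1, hx' _ hx.2⟩
  · intro T
    refine forall_congr' fun ω => ?_
    have : ∫ x in N, ω x (R.orient x) * u x ∂(Measure.hausdorffMeasure 1) =
        ∫ x, ω x (R.orient x) * u x ∂(R.lengthMeasure) := by
      rw [← hres, ← integral_indicator₀ hNR]
      refine integral_congr_ae ?_
      filter_upwards [hoff] with x hx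
      by_cases hxN : x ∈ N
      · rw [Set.indicator_of_mem hxN]
      · rw [Set.indicator_of_notMem hxN, hx hxN, mul_zero]
    rw [← this]
  · intro α hα
    change ∫⁻ x in N, ENNReal.ofReal (u x ^ α) ∂(Measure.hausdorffMeasure 1) = _
    rw [← hres, ← lintegral_indicator₀ hNR]
    refine lintegral_congr_ae ?_
    filter_upwards [hoff] with x hx
    by_cases hxN : x ∈ N
    · rw [Set.indicator_of_mem hxN]
    · rw [Set.indicator_of_notMem hxN, hx hxN, Real.zero_rpow hα.ne', ENNReal.ofReal_zero]

/-- The vector field `θ ξ`, extended by zero outside the carrier: the density of the current with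
respect to `ℋ¹`. -/
noncomputable def density (R : RectifiableTriple m) : Space m → Space m :=
  R.carrier.indicator fun x => R.mult x • R.orient x

theorem locallyIntegrable_density (R : RectifiableTriple m) :
    LocallyIntegrable R.density (Measure.hausdorffMeasure 1) := by
  have h : LocallyIntegrable (fun x => R.mult x • R.orient x) R.lengthMeasure := by
    refine R.locallyIntegrable_mult.mono
      (R.locallyIntegrable_mult.aestronglyMeasurable.smul R.aestronglyMeasurable_orient) ?_
    filter_upwards [R.orient_tangent] with x hx
    rw [norm_smul, hx.1, mul_one]
  intro x
  obtain ⟨U, hU, hi⟩ := h x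
  obtain ⟨V, hVU, hV, hxV⟩ := mem_nhds_iff.1 hU
  refine ⟨V, hV.mem_nhds hxV, ?_⟩
  have hi' := hi.mono_set hVU
  unfold IntegrableOn at hi' ⊢
  rw [Measure.restrict_restrict hV.measurableSet, Set.inter_comm,
    ← Measure.restrict_restrict₀ (R.nullMeasurableSet_carrier.mono Measure.restrict_le_self)]
    at hi'
  exact IntegrableOn.integrable_indicator₀ hi'
    (R.nullMeasurableSet_carrier.mono Measure.restrict_le_self)

theorem Represents.apply_eq_integral_density {R : RectifiableTriple m} {T : OneCurrent m}
    (h : R.Represents T) (ω : OneForm m) :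
    T ω = ∫ x, ω x (R.density x) ∂(Measure.hausdorffMeasure 1) := by
  rw [h ω, ← integral_indicator₀ R.nullMeasurableSet_carrier]
  congr 1 with x
  by_cases hx : x ∈ R.carrier
  · simp [density, hx, mul_comm]
  · simp [density, hx]

/-- A current determines the density `θ ξ` of the triples representing it. -/
theorem Represents.density_ae_eq {R R' : RectifiableTriple m} {T : OneCurrent m}
    (h : R.Represents T) (h' : R'.Represents T) :
    ∀ᵐ x ∂(Measure.hausdorffMeasure 1), R.density x = R'.density x := by
  refine ae_eq_of_integral_contDiff_smul_eq R.locallyIntegrable_density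
    R'.locallyIntegrable_density fun g hg hgc => ?_
  have hi := R.locallyIntegrable_density.integrable_smul_left_of_hasCompactSupport
    hg.continuous hgc
  have hi' := R'.locallyIntegrable_density.integrable_smul_left_of_hasCompactSupport
    hg.continuous hgc
  refine ext_inner_left ℝ fun c => ?_
  rw [← integral_inner hi, ← integral_inner hi']
  -- test the current with the form `g ⟪c, ·⟫`
  let ω : OneForm m := ⟨fun x => g x • innerSL ℝ c, hg.smul contDiff_const,
    hgc.smul_right, fun _ _ => trivial⟩
  have hω : ∀ x y, ω x y = inner ℝ c (g x • y) := fun x y => by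
    rw [inner_smul_right]; rfl
  simp only [← hω]
  rw [← h.apply_eq_integral_density, ← h'.apply_eq_integral_density]

/-- For `α > 0` the cost only depends on the density, since `0 ^ α = 0` outside the carrier. -/
theorem cost_eq_lintegral_density (R : RectifiableTriple m) {α : ℝ} (hα : 0 < α) :
    R.cost α = ∫⁻ x, ENNReal.ofReal (‖R.density x‖ ^ α) ∂(Measure.hausdorffMeasure 1) := by
  unfold cost
  rw [← lintegral_indicator₀ R.nullMeasurableSet_carrier]
  refine lintegral_congr_ae ?_
  filter_upwards [(ae_restrict_iff'₀ R.nullMeasurableSet_carrier).1 R.orient_tangent] with x hx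
  by_cases hxM : x ∈ R.carrier
  · simp [density, hxM, norm_smul, (hx hxM).1, abs_of_pos (R.mult_pos x hxM)]
  · simp [density, hxM, Real.zero_rpow hα.ne']

/-- The infimum defining the transport cost is attained at every triple representing the current. -/
theorem Represents.transportCost_eq {R : RectifiableTriple m} {T : OneCurrent m}
    (h : R.Represents T) {α : ℝ} (hα : 0 < α) : transportCost α T = R.cost α := by
  refine le_antisymm (iInf₂_le R h) (le_iInf₂ fun R' h' => ?_)
  rw [cost_eq_lintegral_density _ hα, cost_eq_lintegral_density _ hα]
  refine (lintegral_congr_ae ?_).le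
  filter_upwards [h.density_ae_eq h'] with x hx
  rw [hx]

end RectifiableTriple

/-! ### Perturbation by a current on `T` -/

/-- A current on `T = τ(M, θ, ξ)` is of the form `ω ↦ ∫_M ⟨ω, ξ⟩ w dℋ¹` with a signed multiplicity
`w` satisfying `|w| ≤ θ`: the orientations of the two currents agree up to sign because
approximate tangent lines are local and unique. -/
theorem IsOn.exists_signed_mult {m : ℕ} {S T : OneCurrent m} (h : IsOn S T) :
    ∃ (R : RectifiableTriple m) (w : Space m → ℝ), R.Represents T ∧
      AEStronglyMeasurable w R.lengthMeasure ∧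
      (∀ᵐ x ∂(R.lengthMeasure), |w x| ≤ R.mult x) ∧
      ∀ ω, S ω = ∫ x, ω x (R.orient x) * w x ∂(R.lengthMeasure) := by
  obtain ⟨RS, RT, hS, hT, hnull, hmult⟩ := h
  have hNM : RS.carrier ≤ᵐ[Measure.hausdorffMeasure 1] RT.carrier := ae_le_set.2 hnull
  have hN := RS.nullMeasurableSet_carrier
  have hle : RS.lengthMeasure ≤ RT.lengthMeasure := Measure.restrict_mono_ae hNM
  have horient : ∀ᵐ x ∂(RS.lengthMeasure), ‖RT.orient x‖ = 1 ∧ ‖RS.orient x‖ = 1 ∧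
      RS.orient x = inner ℝ (RT.orient x) (RS.orient x) • RT.orient x := by
    have hloc := ae_isApproxTangentLine_of_abs_le (C := 1) RT.nullMeasurableSet_carrier hN hNM
      RT.mult_pos RT.locallyIntegrable_mult RS.locallyIntegrable_mult.aestronglyMeasurable
      zero_le_one (by
        filter_upwards [hmult, RS.ae_mult_pos] with x hx hx'
        rwa [abs_of_pos hx', one_mul])
    filter_upwards [hloc, ae_mono hle RT.orient_tangent, RS.orient_tangent, RS.ae_mult_pos]
      with x hx hxT hxS hpos
    exact ⟨hxT.1, hxS.1, (hx _ hxT.2).eq_inner_smul hpos.ne' hxT.1 hxS.1 hxS.2⟩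
  set w₀ : Space m → ℝ := fun x => RS.mult x * inner ℝ (RT.orient x) (RS.orient x) with hw₀
  have hw₀m : AEStronglyMeasurable w₀ RS.lengthMeasure :=
    RS.locallyIntegrable_mult.aestronglyMeasurable.mul
      ((RT.aestronglyMeasurable_orient.mono_measure hle).inner RS.aestronglyMeasurable_orient)
  have hbound : ∀ᵐ x ∂(RS.lengthMeasure), |w₀ x| ≤ RT.mult x := by
    filter_upwards [horient, hmult, RS.ae_mult_pos] with x hx hx' hpos
    have h1 : |inner ℝ (RT.orient x) (RS.orient x)| ≤ 1 := by
      simpa [hx.1, hx.2.1] using abs_real_inner_le_norm (RT.orient x) (RS.orient x)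
    rw [hw₀, abs_mul, abs_of_pos hpos]
    exact (mul_le_of_le_one_right hpos.le h1).trans hx'
  refine ⟨RT, RS.carrier.indicator w₀, hT, ?_, ?_, fun ω => ?_⟩
  · exact ((aestronglyMeasurable_indicator_iff₀ hN).2 hw₀m).mono_measure Measure.restrict_le_self
  · filter_upwards [RT.ae_mult_pos, ae_restrict_of_ae ((ae_restrict_iff'₀ hN).1 hbound)]
      with x hx hx'
    by_cases hxN : x ∈ RS.carrier
    · rw [Set.indicator_of_mem hxN]; exact hx' hxN
    · rw [Set.indicator_of_notMem hxN, abs_zero]; exact hx.le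
  · have h1 : ∀ x, ω x (RT.orient x) * RS.carrier.indicator w₀ x =
        RS.carrier.indicator (fun x => ω x (RT.orient x) * w₀ x) x := fun x => by
      by_cases hx : x ∈ RS.carrier <;> simp [hx]
    simp only [h1]
    rw [setIntegral_indicator_of_ae_le hN hNM, hS ω]
    refine integral_congr_ae ?_
    filter_upwards [horient] with x hx
    have hω : ω x (RS.orient x) = inner ℝ (RT.orient x) (RS.orient x) * ω x (RT.orient x) := by
      conv_lhs => rw [hx.2.2]
      rw [map_smul, smul_eq_mul]
    rw [hω, hw₀]
    ring

/-- Strict concavity of `t ↦ t ^ α` at the midpoint of `t + s` and `t - s`. -/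
theorem add_rpow_sub_rpow_le {α t s : ℝ} (hα0 : 0 < α) (hα1 : α < 1) (hs : |s| ≤ t) :
    (t + s) ^ α + (t - s) ^ α ≤ 2 * t ^ α ∧
      ((t + s) ^ α + (t - s) ^ α = 2 * t ^ α → s = 0) := by
  obtain ⟨h1, h2⟩ := abs_le.1 hs
  by_cases h0 : s = 0
  · subst h0
    refine ⟨?_, fun _ => rfl⟩
    rw [add_zero, sub_zero, two_mul]
  · have h := (Real.strictConcaveOn_rpow hα0 hα1).2
      (Set.mem_Ici.2 (show 0 ≤ t + s by linarith)) (Set.mem_Ici.2 (show 0 ≤ t - s by linarith))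
      (fun h => h0 (by linarith)) (show (0 : ℝ) < 1 / 2 by norm_num)
      (show (0 : ℝ) < 1 / 2 by norm_num) (by norm_num)
    have h3 : (1 / 2 : ℝ) • (t + s) + (1 / 2 : ℝ) • (t - s) = t := by
      simp only [smul_eq_mul]; ring
    simp only [h3] at h
    simp only [smul_eq_mul] at h
    exact ⟨by linarith, fun h' => absurd h' (by linarith)⟩

theorem OneCurrent.add_neg_one_smul {m : ℕ} (T S : OneCurrent m) : T + (-1 : ℝ) • S = T - S := by
  ext ω
  change T ω + (-1 : ℝ) * S ω = T ω - S ω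
  ring

theorem isTransportPath_add_smul {m : ℕ} {μminus μplus : Measure (Space m)} {S T : OneCurrent m}
    (hT : IsTransportPath μminus μplus T) (hS : boundary S = 0) {ε : ℝ}
    (hrect : IsRectifiable (T + ε • S)) : IsTransportPath μminus μplus (T + ε • S) := by
  refine ⟨hrect, fun f => ?_⟩
  have h0 : S (extDeriv₀ m f) = 0 := DFunLike.congr_fun hS f
  rw [← hT.2 f]
  change T (extDeriv₀ m f) + ε • S (extDeriv₀ m f) = T (extDeriv₀ m f)
  rw [h0, smul_zero, add_zero]

/-- If `S` is on `T`, then `T + ε S` is rectifiable, with multiplicity `θ + ε w` where `w` is the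
signed multiplicity of `S` along the orientation of `T`. -/
theorem IsOn.exists_cost_eq {m : ℕ} {S T : OneCurrent m} (h : IsOn S T) {α : ℝ} (hα : 0 < α) :
    ∃ (R : RectifiableTriple m) (w : Space m → ℝ),
      AEStronglyMeasurable w R.lengthMeasure ∧
      (∀ᵐ x ∂(R.lengthMeasure), |w x| ≤ R.mult x) ∧
      (∀ ω, S ω = ∫ x, ω x (R.orient x) * w x ∂(R.lengthMeasure)) ∧
      ∀ ε ∈ Set.Icc (-1 : ℝ) 1, IsRectifiable (T + ε • S) ∧
        transportCost α (T + ε • S) =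
          ∫⁻ x, ENNReal.ofReal ((R.mult x + ε * w x) ^ α) ∂(R.lengthMeasure) := by
  obtain ⟨R, w, hT, hw, hwle, hS⟩ := h.exists_signed_mult
  refine ⟨R, w, hw, hwle, hS, fun ε hε => ?_⟩
  have hεw : ∀ᵐ x ∂(R.lengthMeasure), |ε * w x| ≤ R.mult x := by
    filter_upwards [hwle] with x hx
    rw [abs_mul]
    exact (mul_le_of_le_one_left (abs_nonneg _) (abs_le.2 hε)).trans hx
  have hθm := R.locallyIntegrable_mult.aestronglyMeasurable
  obtain ⟨R', hrep, hcost⟩ := R.exists_reweight (u := fun x => R.mult x + ε * w x) (C := 2)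
    (hθm.add (hw.const_mul ε))
    (by filter_upwards [hεw] with x hx; linarith [(abs_le.1 hx).1]) zero_le_two
    (by filter_upwards [hεw] with x hx; linarith [(abs_le.1 hx).2])
  have hR' : R'.Represents (T + ε • S) := by
    rw [hrep]
    intro ω
    have hi1 : Integrable (fun x => ω x (R.orient x) * R.mult x) R.lengthMeasure :=
      R.integrable_apply_orient_mul ω (C := 1) hθm (by
        filter_upwards [R.ae_mult_pos] with x hx
        rw [abs_of_pos hx, one_mul])
    have hi2 : Integrable (fun x => ω x (R.orient x) * w x) R.lengthMeasure :=
      R.integrable_apply_orient_mul ω (C := 1) hw (by simpa using hwle)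
    change T ω + ε • S ω = _
    rw [hT ω, hS ω, smul_eq_mul, ← integral_const_mul, ← integral_add hi1 (hi2.const_mul ε)]
    congr 1 with x
    ring
  exact ⟨⟨R', hR'⟩, by rw [hR'.transportCost_eq hα, hcost α hα]⟩

/-- Strict concavity of `t ↦ t ^ α`, integrated. -/
theorem IsOn.min_transportCost_le {m : ℕ} {S T : OneCurrent m} (h : IsOn S T) {α : ℝ}
    (hα0 : 0 < α) (hα1 : α < 1) (hfin : transportCost α T < ⊤) :
    min (transportCost α (T + S)) (transportCost α (T - S)) ≤ transportCost α T ∧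
      (min (transportCost α (T + S)) (transportCost α (T - S)) = transportCost α T → S = 0) := by
  obtain ⟨R, w, hw, hwle, hS, hcost⟩ := h.exists_cost_eq hα0
  have hadd := (hcost 1 (by norm_num)).2
  have hsub := (hcost (-1) (by norm_num)).2
  have hzero := (hcost 0 (by norm_num)).2
  simp only [one_smul, one_mul] at hadd
  simp only [OneCurrent.add_neg_one_smul, neg_mul, one_mul, ← sub_eq_add_neg] at hsub
  simp only [zero_smul, add_zero, zero_mul] at hzero
  have hθm := R.locallyIntegrable_mult.aestronglyMeasurable.aemeasurable
  have hm1 : AEMeasurable (fun x => ENNReal.ofReal ((R.mult x + w x) ^ α)) R.lengthMeasure :=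
    ((hθm.add hw.aemeasurable).pow_const α).ennreal_ofReal
  have hm0 : AEMeasurable (fun x => ENNReal.ofReal (R.mult x ^ α)) R.lengthMeasure :=
    (hθm.pow_const α).ennreal_ofReal
  have hsum : transportCost α (T + S) + transportCost α (T - S) =
      ∫⁻ x, (ENNReal.ofReal ((R.mult x + w x) ^ α) + ENNReal.ofReal ((R.mult x - w x) ^ α))
        ∂(R.lengthMeasure) := by
    rw [hadd, hsub, lintegral_add_left' hm1]
  have htwo : transportCost α T + transportCost α T =
      ∫⁻ x, (ENNReal.ofReal (R.mult x ^ α) + ENNReal.ofReal (R.mult x ^ α))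
        ∂(R.lengthMeasure) := by
    rw [hzero, lintegral_add_left' hm0]
  have hpt : ∀ᵐ x ∂(R.lengthMeasure),
      ENNReal.ofReal ((R.mult x + w x) ^ α) + ENNReal.ofReal ((R.mult x - w x) ^ α) =
        ENNReal.ofReal ((R.mult x + w x) ^ α + (R.mult x - w x) ^ α) ∧
      ENNReal.ofReal (R.mult x ^ α) + ENNReal.ofReal (R.mult x ^ α) =
        ENNReal.ofReal (2 * R.mult x ^ α) ∧ 0 ≤ (R.mult x + w x) ^ α + (R.mult x - w x) ^ α ∧
        0 ≤ 2 * R.mult x ^ α := by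
    filter_upwards [hwle, R.ae_mult_pos] with x hx hpos
    obtain ⟨h1, h2⟩ := abs_le.1 hx
    have h3 := Real.rpow_nonneg (show 0 ≤ R.mult x + w x by linarith) α
    have h4 := Real.rpow_nonneg (show 0 ≤ R.mult x - w x by linarith) α
    have h5 := Real.rpow_nonneg hpos.le α
    exact ⟨(ENNReal.ofReal_add h3 h4).symm, by rw [two_mul, ENNReal.ofReal_add h5 h5],
      by positivity, by positivity⟩
  have hle : ∀ᵐ x ∂(R.lengthMeasure),
      ENNReal.ofReal ((R.mult x + w x) ^ α) + ENNReal.ofReal ((R.mult x - w x) ^ α) ≤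
        ENNReal.ofReal (R.mult x ^ α) + ENNReal.ofReal (R.mult x ^ α) := by
    filter_upwards [hwle, hpt] with x hx hx'
    rw [hx'.1, hx'.2.1]
    exact ENNReal.ofReal_le_ofReal (add_rpow_sub_rpow_le hα0 hα1 hx).1
  have hsumle : transportCost α (T + S) + transportCost α (T - S) ≤
      transportCost α T + transportCost α T := by
    rw [hsum, htwo]
    exact lintegral_mono_ae hle
  constructor
  · by_contra hlt
    rw [not_le, lt_min_iff] at hlt
    exact absurd hsumle (not_le.2 (ENNReal.add_lt_add hlt.1 hlt.2))
  · intro heq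
    have heq2 : transportCost α (T + S) + transportCost α (T - S) =
        transportCost α T + transportCost α T :=
      le_antisymm hsumle (add_le_add (heq ▸ min_le_left _ _) (heq ▸ min_le_right _ _))
    have hne : transportCost α (T + S) + transportCost α (T - S) ≠ ⊤ := by
      rw [heq2]
      exact (ENNReal.add_lt_top.2 ⟨hfin, hfin⟩).ne
    -- equal finite integrals of ordered functions force equality almost everywhere
    have hae := ae_eq_of_ae_le_of_lintegral_le hle (hsum ▸ hne) (hm0.add hm0)
      (by rw [← hsum, ← htwo, heq2])
    have hw0 : ∀ᵐ x ∂(R.lengthMeasure), w x = 0 := by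
      filter_upwards [hae, hpt, hwle] with x hx hx' hxw
      rw [hx'.1, hx'.2.1, ENNReal.ofReal_eq_ofReal_iff hx'.2.2.1 hx'.2.2.2] at hx
      exact (add_rpow_sub_rpow_le hα0 hα1 hxw).2 hx
    ext ω
    rw [hS ω]
    refine integral_eq_zero_of_ae ?_
    filter_upwards [hw0] with x hx
    rw [hx, mul_zero, Pi.zero_apply]

end RamifiedTransport

theorem mainTheorem7 (m : ℕ) (α : ℝ) (hα0 : 0 < α) (hα1 : α < 1)
    (μminus μplus : MeasureTheory.Measure (RamifiedTransport.Space m))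
    [MeasureTheory.IsFiniteMeasure μminus] [MeasureTheory.IsFiniteMeasure μplus]
    (T : RamifiedTransport.OneCurrent m)
    (hT : RamifiedTransport.transportCost α T < ⊤) :
    (RamifiedTransport.IsTransportPath μminus μplus T →
      ∀ S : RamifiedTransport.OneCurrent m, RamifiedTransport.IsCycleOn S T →
        (∀ ε : ℝ, ε ∈ Set.Icc (-1 : ℝ) 1 →
          RamifiedTransport.IsTransportPath μminus μplus (T + ε • S)) ∧
        min (RamifiedTransport.transportCost α (T + S))
            (RamifiedTransport.transportCost α (T - S))
          ≤ RamifiedTransport.transportCost α T ∧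
        (min (RamifiedTransport.transportCost α (T + S))
            (RamifiedTransport.transportCost α (T - S))
          = RamifiedTransport.transportCost α T → S = 0)) ∧
    (RamifiedTransport.IsOptimalPath α μminus μplus T → RamifiedTransport.IsCycleFree T) := by
  have hpath : RamifiedTransport.IsTransportPath μminus μplus T →
      ∀ S : RamifiedTransport.OneCurrent m, RamifiedTransport.IsCycleOn S T →
        ∀ ε : ℝ, ε ∈ Set.Icc (-1 : ℝ) 1 →
          RamifiedTransport.IsTransportPath μminus μplus (T + ε • S) := by
    intro hTp S hS ε hε
    obtain ⟨_, _, _, _, _, hcost⟩ := hS.1.exists_cost_eq hα0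
    exact RamifiedTransport.isTransportPath_add_smul hTp hS.2 (hcost ε hε).1
  refine ⟨fun hTp S hS => ⟨hpath hTp S hS, hS.1.min_transportCost_le hα0 hα1 hT⟩,
    fun hopt => ⟨hopt.1.1, fun S hS => ?_⟩⟩
  obtain ⟨hle, heq⟩ := hS.1.min_transportCost_le hα0 hα1 hT
  have hadd := hpath hopt.1 S hS 1 (by norm_num)
  have hsub := hpath hopt.1 S hS (-1) (by norm_num)
  rw [one_smul] at hadd
  rw [RamifiedTransport.OneCurrent.add_neg_one_smul] at hsub
  exact heq (le_antisymm hle (le_min (hopt.2 _ hadd) (hopt.2 _ hsub)))
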